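/- Let $d\ge 1$, $\kappa>1$, $\theta=\kappa/(\kappa-1)$ and $C\in\mathbb R$. Let $L:[e,\infty)\to(0,\infty)$ be twice continuously differentiable and slowly varying at infinity (that is, $L(cr)/L(r)\to 1$ as $r\to\infty$ for every $c>0$), and suppose that $\lim_{r\to\infty} L(r)/L(r/L(r))=1$. For $\lambda\in\mathbb R^d$, with $|\cdot|$ the Euclidean norm, put $$\zeta_{\kappa,L}(\lambda)=\kappa^{-1}|\lambda|^{\kappa}\,L\big(|\lambda|^{\kappa}\big)^{1/\theta}\ \text{ if } |\lambda|\ge e,\qquad \zeta_{\kappa,L}(\lambda)=C|\lambda|^2\ \text{ if } |\lambda|<e .$$ Write $\Lambda(x)=\min_i x(i)$ for $x\in\mathbb R^d$. For $f:\mathbb R^d\to\mathbb R$ let $f^*(y)=\sup_{x\in\mathbb R^d}\big((x,y)-f(x)\big)$ be its Young–Fenchel transform, and let $I[f](\lambda)=\int_{\mathbb R^d}e^{(\lambda,x)-f(x)}\,dx$ be its Laplace integral. Then: 1. The transform $\zeta_{\kappa,L}^*(x)$ is finite for every $x\in\mathbb R^d$, the integral $I_{\kappa,L}(\lambda):=I[\zeta_{\kappa,L}^*](\lambda)$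 converges for every $\lambda\in\mathbb R^d$, and $$\lim_{\Lambda(\lambda)\to\infty}\frac{\ln I_{\kappa,L}(\lambda)}{\zeta_{\kappa,L}(\lambda)}=1 .$$ 2. Conversely, let $\varphi:\mathbb R\to\mathbb R$ be a Young–Orlicz function, i.e. even and convex with $\varphi(0)=0$ and $\varphi(t)\to\infty$ as $t\to\infty$, and let $\zeta(x)=\varphi(|x|)$ for $x\in\mathbb R^d$. If $I[\zeta](\lambda)$ converges whenever $\Lambda(\lambda)$ is large enough and $$\lim_{\Lambda(\lambda)\to\infty}\frac{\ln I[\zeta](\lambda)}{\zeta_{\kappa,L}(\lambda)}=1,\qquad\text{then}\qquad \lim_{\Lambda(x)\to\infty}\frac{\zeta(x)}{\zeta_{\kappa,L}^*(x)}=1 .$$ -/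

import Mathlib

open Real Filter Topology MeasureTheory

noncomputable section

/-- `Λ(x) = min_i x(i)` for a vector `x` of `ℝ^d`, `d ≥ 1`. -/
def minCoord {d : ℕ} (x : EuclideanSpace ℝ (Fin d)) : ℝ :=
  ⨅ i, x i

/-- The filter of the limits "as `Λ(x) = min_i x(i) → ∞`". -/
def minCoordAtTop (d : ℕ) : Filter (EuclideanSpace ℝ (Fin d)) :=
  comap minCoord atTop

/-- The Young-Fenchel transform `f*(y) = sup_x ((x, y) - f(x))` over the whole space `ℝ^d`.
It is the true supremum wherever `YoungFenchelFinite f y` holds. -/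
def youngFenchel {d : ℕ} (f : EuclideanSpace ℝ (Fin d) → ℝ)
    (y : EuclideanSpace ℝ (Fin d)) : ℝ :=
  ⨆ x, (inner ℝ x y - f x)

/-- The supremum that defines `f*(y)` is finite. -/
def YoungFenchelFinite {d : ℕ} (f : EuclideanSpace ℝ (Fin d) → ℝ)
    (y : EuclideanSpace ℝ (Fin d)) : Prop :=
  BddAbove (Set.range fun x => inner ℝ x y - f x)

/-- The integrand `x ↦ exp ((lam, x) - f(x))` of the Laplace integral. -/
def laplaceIntegrand {d : ℕ} (f : EuclideanSpace ℝ (Fin d) → ℝ)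
    (lam x : EuclideanSpace ℝ (Fin d)) : ℝ :=
  exp (inner ℝ lam x - f x)

/-- The Laplace (exponential) integral `I[f](lam) = ∫_{ℝ^d} exp ((lam, x) - f(x)) dx` with respect
to Lebesgue measure. -/
def laplaceIntegral {d : ℕ} (f : EuclideanSpace ℝ (Fin d) → ℝ)
    (lam : EuclideanSpace ℝ (Fin d)) : ℝ :=
  ∫ x, laplaceIntegrand f lam x

/-- `L`, considered on `[e, ∞)`, is positive and slowly varying at infinity.
(For the functions considered here `L` is moreover continuous on `[e, ∞)`.) -/
structure IsSlowlyVarying (L : ℝ → ℝ) : Prop where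
  pos : ∀ r, exp 1 ≤ r → 0 < L r
  tendsto : ∀ c : ℝ, 0 < c → Tendsto (fun r => L (c * r) / L r) atTop (𝓝 1)

/-- The radial function on `ℝ^d` equal to `κ⁻¹ |lam|^κ L(|lam|^κ)^(1/θ)` for `|lam| ≥ e` and to
`C |lam|²` for `|lam| < e`, where `θ = κ / (κ - 1)`. -/
def zetaKL {d : ℕ} (κ C : ℝ) (L : ℝ → ℝ) (lam : EuclideanSpace ℝ (Fin d)) : ℝ :=
  if exp 1 ≤ ‖lam‖ then κ⁻¹ * ‖lam‖ ^ κ * L (‖lam‖ ^ κ) ^ (1 / (κ / (κ - 1)))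
  else C * ‖lam‖ ^ 2

/-- Finite-valued Young-Orlicz functions of one real variable: even, convex, zero at the origin and
tending to infinity at infinity. (Such a function is automatically continuous, non-negative, and
non-decreasing on `[0, ∞)`.) -/
structure IsYoungOrlicz (φ : ℝ → ℝ) : Prop where
  even : ∀ t, φ (-t) = φ t
  convex : ConvexOn ℝ Set.univ φ
  zero : φ 0 = 0
  tendsto : Tendsto φ atTop atTop

end

/-! Slow variation of `L` makes the radial profile g of ζ regularly varying of index κ > 1, and the
argument uses nothing else about g except a lower bound on [0, ∞) and continuity and positivity far
out. Potter bounds (`IsSlowlyVarying.potter`) say that g(r)/g(R) behaves like (r/R)^κ up to small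
errors. Hence g lies almost above its tangent at R (`tangent_le`), and at the slope t = κ g(R)/R its
conjugate g* is (κ - 1 + o(1)) g(R).

Direct part: write R = |λ|. Young's inequality g*(s) ≥ qRs - g(qR) with q slightly above 1 bounds ln
I above by g(qR) + O(1), which is close to g(R). A unit ball near distance t in the direction of λ
bounds it below by Rt - g*(t) - O(R), where Rt = κ g(R).

Converse: the same ball gives φ(t) ≥ (κ - 1 - o(1)) g(R). For the upper bound, an affine minorant cs
- m of φ forces ln I at radius c/q to be at most m + O(1), so m ≥ a g(c) with a < 1 close to 1.
Applied to a minorant almost touching φ at t, the tangent inequality gives φ(t) ≤ (κ - 1 + o(1))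
g(R). Every large t is such a slope, so φ/g* → 1. -/

noncomputable section

/-! ### Uniform convergence and Potter bounds -/

/-- Local form of the uniform convergence theorem for continuous additively slowly varying
functions. -/
theorem exists_uniform_small_shift {F : ℝ → ℝ} (hF : Continuous F)
    (hlim : ∀ t, Tendsto (fun x => F (x + t) - F x) atTop (𝓝 0)) {ε : ℝ} (hε : 0 < ε) :
    ∃ δ > 0, ∃ X, ∀ x ≥ X, ∀ s, 0 ≤ s → s ≤ δ → |F (x + s) - F x| ≤ ε := by
  let E : ℕ → Set ℝ := fun n => {t | ∀ x : ℝ, (n : ℝ) ≤ x → |F (x + t) - F x| ≤ ε / 2}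
  have hclosed : ∀ n, IsClosed (E n) := fun n => by
    simp only [E, Set.ofPred_forall]
    exact isClosed_iInter fun x => isClosed_iInter fun _ =>
      isClosed_le (by fun_prop) continuous_const
  have hcover : ⋃ n, E n = Set.univ := by
    refine Set.eq_univ_of_forall fun t => ?_
    have h := (Metric.tendsto_nhds.1 (hlim t)) (ε / 2) (by positivity)
    obtain ⟨X, hX⟩ := eventually_atTop.1 h
    obtain ⟨n, hn⟩ := exists_nat_ge X
    refine Set.mem_iUnion.2 ⟨n, fun x hx => ?_⟩
    simpa using (hX x (hn.trans hx)).le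
  -- Baire: some `E n` contains an interval around `a`. A small shift `s` is the difference of the
  -- shifts `a + s` and `a`, both based at `x - a`.
  obtain ⟨n, a, ha⟩ := nonempty_interior_of_iUnion_of_closed hclosed hcover
  obtain ⟨η, hη, hball⟩ := Metric.isOpen_iff.1 isOpen_interior a ha
  have hmem : ∀ s, 0 ≤ s → s < η → a + s ∈ E n := fun s hs hsη =>
    interior_subset (hball (by simpa [Real.dist_eq, abs_of_nonneg hs] using hsη))
  refine ⟨η / 2, by positivity, n + a, fun x hx s hs hsδ => ?_⟩
  have h1 := hmem s hs (by linarith) (x - a) (by linarith)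
  have h0 := hmem 0 le_rfl hη (x - a) (by linarith)
  simp only [add_zero, sub_add_cancel] at h0
  rw [show x - a + (a + s) = x + s by ring] at h1
  rw [abs_le] at *
  constructor <;> linarith

/-- Uniform convergence on `[0, 1]` for continuous additively slowly varying functions. -/
theorem exists_uniform_small_unit_shift {F : ℝ → ℝ} (hF : Continuous F)
    (hlim : ∀ t, Tendsto (fun x => F (x + t) - F x) atTop (𝓝 0)) {ε : ℝ} (hε : 0 < ε) :
    ∃ X, ∀ x ≥ X, ∀ s, 0 ≤ s → s ≤ 1 → |F (x + s) - F x| ≤ ε := by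
  obtain ⟨δ, hδ, X, hX⟩ := exists_uniform_small_shift hF hlim (half_pos hε)
  -- Finitely many multiples of `δ` reach every point of [0, 1] up to a remainder below `δ`, which
  -- the local form handles.
  have hgrid : ∀ᶠ x in atTop, ∀ k ∈ Finset.range (⌊1 / δ⌋₊ + 1),
      |F (x + k * δ) - F x| ≤ ε / 2 := by
    rw [Filter.eventually_all_finset]
    intro k _
    filter_upwards [(Metric.tendsto_nhds.1 (hlim (k * δ))) (ε / 2) (by positivity)] with x hx
    simpa using hx.le
  obtain ⟨Y, hY⟩ := eventually_atTop.1 hgrid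
  refine ⟨max X Y, fun x hx s hs hs1 => ?_⟩
  have hk : (⌊s / δ⌋₊ : ℝ) * δ ≤ s := by
    rw [← le_div_iff₀ hδ]; exact Nat.floor_le (by positivity)
  have hk' : s < (⌊s / δ⌋₊ + 1 : ℝ) * δ := by
    rw [← div_lt_iff₀ hδ]; exact Nat.lt_floor_add_one _
  have h1 := hY x ((le_max_right _ _).trans hx) ⌊s / δ⌋₊ (by
    rw [Finset.mem_range, Nat.lt_succ_iff]
    exact Nat.floor_le_floor (by gcongr))
  have hnn : (0 : ℝ) ≤ ⌊s / δ⌋₊ * δ := by positivity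
  have h2 := hX (x + ⌊s / δ⌋₊ * δ) (by linarith [le_max_left X Y]) (s - ⌊s / δ⌋₊ * δ)
    (by linarith) (by linarith)
  rw [show x + ⌊s / δ⌋₊ * δ + (s - ⌊s / δ⌋₊ * δ) = x + s by ring] at h2
  rw [abs_le] at *
  constructor <;> linarith

/-- Potter bounds in additive form. -/
theorem exists_abs_sub_le_of_tendsto_shift {F : ℝ → ℝ} (hF : Continuous F)
    (hlim : ∀ t, Tendsto (fun x => F (x + t) - F x) atTop (𝓝 0)) {ε : ℝ} (hε : 0 < ε) :
    ∃ X, ∀ x ≥ X, ∀ y ≥ X, |F y - F x| ≤ ε * (1 + |y - x|) := by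
  obtain ⟨X, hX⟩ := exists_uniform_small_unit_shift hF hlim hε
  have hnat : ∀ x ≥ X, ∀ n : ℕ, |F (x + n) - F x| ≤ ε * n := by
    intro x hx n
    induction n with
    | zero => simp
    | succ n ih =>
      have h := hX (x + n) (by have : (0 : ℝ) ≤ n := by positivity
                               linarith) 1 zero_le_one le_rfl
      push_cast
      rw [← add_assoc]
      rw [abs_le] at *
      constructor <;> linarith
  have hle : ∀ x ≥ X, ∀ y ≥ x, |F y - F x| ≤ ε * (1 + (y - x)) := by
    intro x hx y hy
    have hn := Nat.floor_le (sub_nonneg.2 hy)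
    have hn' := Nat.lt_floor_add_one (y - x)
    have hnn : (0 : ℝ) ≤ ⌊y - x⌋₊ := by positivity
    have h1 := hnat x hx ⌊y - x⌋₊
    have h2 := hX (x + ⌊y - x⌋₊) (by linarith) (y - x - ⌊y - x⌋₊) (by linarith) (by linarith)
    rw [show x + ⌊y - x⌋₊ + (y - x - ⌊y - x⌋₊) = y by ring] at h2
    have h3 : ε * ⌊y - x⌋₊ ≤ ε * (y - x) := by gcongr
    rw [abs_le] at *
    constructor <;> linarith
  refine ⟨X, fun x hx y hy => ?_⟩
  rcases le_total x y with h | h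
  · rw [abs_of_nonneg (sub_nonneg.2 h)]; exact hle x hx y h
  · rw [abs_sub_comm, abs_sub_comm y x, abs_of_nonneg (sub_nonneg.2 h)]; exact hle y hy x h

/-- Potter bounds for a continuous slowly varying function. -/
theorem IsSlowlyVarying.potter {L : ℝ → ℝ} (hL : IsSlowlyVarying L)
    (hcont : ContinuousOn L (Set.Ici (exp 1))) {ε : ℝ} (hε : 0 < ε) :
    ∃ X ≥ exp 1, ∀ x ≥ X, ∀ y ≥ X, |log (L y) - log (L x)| ≤ ε * (1 + |log y - log x|) := by
  let F : ℝ → ℝ := fun x => log (L (exp (max x 1)))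
  have harg : ∀ x : ℝ, exp 1 ≤ exp (max x 1) := fun x => exp_le_exp.2 (le_max_right _ _)
  have hF : Continuous F := by
    refine Continuous.log ?_ fun x => (hL.pos _ (harg x)).ne'
    exact hcont.comp_continuous (by fun_prop) harg
  have hlim : ∀ t, Tendsto (fun x => F (x + t) - F x) atTop (𝓝 0) := by
    intro t
    have h := ((continuousAt_log one_ne_zero).tendsto.comp
      ((hL.tendsto (exp t) (exp_pos t)).comp tendsto_exp_atTop))
    rw [log_one] at h
    refine h.congr' ?_
    filter_upwards [eventually_ge_atTop 1, eventually_ge_atTop (1 - t)] with x hx hxt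
    have h1 : max x 1 = x := max_eq_left hx
    have h2 : max (x + t) 1 = x + t := max_eq_left (by linarith)
    have p1 := hL.pos (exp x) (exp_le_exp.2 hx)
    have p2 := hL.pos (exp (x + t)) (exp_le_exp.2 (by linarith))
    simp only [Function.comp, F, h1, h2]
    rw [← exp_add, add_comm t x, log_div p2.ne' p1.ne']
  obtain ⟨X, hX⟩ := exists_abs_sub_le_of_tendsto_shift hF hlim hε
  have key : ∀ x ≥ exp (max X 1), X ≤ log x ∧ F (log x) = log (L x) := by
    intro x hx
    have hx0 : 0 < x := (exp_pos _).trans_le hx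
    have h1 : max X 1 ≤ log x := (le_log_iff_exp_le hx0).2 hx
    refine ⟨(le_max_left _ _).trans h1, ?_⟩
    simp only [F, max_eq_left ((le_max_right X 1).trans h1), exp_log hx0]
  refine ⟨exp (max X 1), harg X, fun x hx y hy => ?_⟩
  obtain ⟨h1, h2⟩ := key x hx
  obtain ⟨h3, h4⟩ := key y hy
  rw [← h2, ← h4]
  exact hX _ h1 _ h3

/-! ### Regular variation of the radial profile -/

/-- The radial profile of `zetaKL`. -/
def profileKL (κ C : ℝ) (L : ℝ → ℝ) (r : ℝ) : ℝ :=
  if exp 1 ≤ r then κ⁻¹ * r ^ κ * L (r ^ κ) ^ (1 / (κ / (κ - 1))) else C * r ^ 2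

theorem zetaKL_eq_profileKL {d : ℕ} (κ C : ℝ) (L : ℝ → ℝ) (x : EuclideanSpace ℝ (Fin d)) :
    zetaKL κ C L x = profileKL κ C L ‖x‖ := rfl

/-- Functions bounded below on `[0, ∞)` that are continuous near infinity and satisfy there Potter
bounds of index `κ`. -/
structure IsRegularProfile (κ : ℝ) (g : ℝ → ℝ) : Prop where
  bddBelow : ∃ B, ∀ r, 0 ≤ r → -B ≤ g r
  continuousOn : ∃ a, ContinuousOn g (Set.Ici a)
  eventually_pos : ∃ a > 0, ∀ r ≥ a, 0 < g r
  potter : ∀ ε > 0, ∃ X > 0, ∀ r ≥ X, ∀ R ≥ X,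
    exp (κ * log (r / R) - ε - ε * |log (r / R)|) * g R ≤ g r

theorem exp_one_le_rpow {κ r : ℝ} (hκ : 1 < κ) (hr : exp 1 ≤ r) : exp 1 ≤ r ^ κ :=
  hr.trans (self_le_rpow_of_one_le ((one_le_exp zero_le_one).trans hr) hκ.le)

theorem IsSlowlyVarying.profileKL_pos {κ C : ℝ} {L : ℝ → ℝ} (hL : IsSlowlyVarying L) (hκ : 1 < κ)
    {r : ℝ} (hr : exp 1 ≤ r) : 0 < profileKL κ C L r := by
  have h0 : 0 < r := (exp_pos 1).trans_le hr
  have := hL.pos _ (exp_one_le_rpow hκ hr)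
  rw [profileKL, if_pos hr]
  positivity

theorem IsSlowlyVarying.isRegularProfile {κ C : ℝ} {L : ℝ → ℝ} (hL : IsSlowlyVarying L)
    (hcont : ContinuousOn L (Set.Ici (exp 1))) (hκ : 1 < κ) :
    IsRegularProfile κ (profileKL κ C L) where
  bddBelow := by
    refine ⟨|C| * exp 1 ^ 2, fun r hr => ?_⟩
    by_cases h : exp 1 ≤ r
    · have := hL.profileKL_pos (C := C) hκ h
      have : 0 ≤ |C| * exp 1 ^ 2 := by positivity
      linarith
    · rw [profileKL, if_neg h, ← mul_neg_one, mul_right_comm]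
      have h1 : -|C| ≤ C := neg_abs_le C
      have h2 : |C| * r ^ 2 ≤ |C| * exp 1 ^ 2 := by
        have := (not_le.1 h).le
        gcongr
      nlinarith [sq_nonneg r]
  continuousOn := by
    refine ⟨exp 1, ContinuousOn.congr (f := fun r => κ⁻¹ * r ^ κ * L (r ^ κ) ^ (1 / (κ / (κ - 1))))
      ?_ fun r hr => if_pos hr⟩
    have hpow : ContinuousOn (fun r : ℝ => r ^ κ) (Set.Ici (exp 1)) := fun r hr =>
      (continuousAt_rpow_const _ _ (Or.inr (by linarith))).continuousWithinAt
    have hcomp : ContinuousOn (fun r : ℝ => L (r ^ κ)) (Set.Ici (exp 1)) :=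
      hcont.comp hpow fun r hr => exp_one_le_rpow hκ hr
    exact (continuousOn_const.mul hpow).mul
      (hcomp.rpow_const fun r hr => Or.inl (hL.pos _ (exp_one_le_rpow hκ hr)).ne')
  eventually_pos := ⟨exp 1, exp_pos 1, fun r hr => hL.profileKL_pos hκ hr⟩
  potter := by
    intro ε hε
    -- Evaluating `L` at `r ^ κ` multiplies logarithmic distances by `κ`, hence `ε / κ`; the outer
    -- exponent 1/θ = (κ - 1)/κ is at most 1 and does no harm.
    obtain ⟨X, hXe, hX⟩ := hL.potter hcont (ε := ε / κ) (by positivity)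
    have hX1 : 1 ≤ X := (one_le_exp zero_le_one).trans hXe
    refine ⟨X, by linarith, fun r hr R hR => ?_⟩
    have hr0 : 0 < r := by linarith
    have hR0 : 0 < R := by linarith
    have hrκ : X ≤ r ^ κ := hr.trans (self_le_rpow_of_one_le (hX1.trans hr) hκ.le)
    have hRκ : X ≤ R ^ κ := hR.trans (self_le_rpow_of_one_le (hX1.trans hR) hκ.le)
    have hLr := hL.pos _ (hXe.trans hrκ)
    have hLR := hL.pos _ (hXe.trans hRκ)
    have hgr := hL.profileKL_pos (C := C) hκ (hXe.trans hr)
    have hgR := hL.profileKL_pos (C := C) hκ (hXe.trans hR)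
    have hlog : ∀ s, X ≤ s → 0 < L (s ^ κ) → log (profileKL κ C L s)
        = log κ⁻¹ + κ * log s + (1 / (κ / (κ - 1))) * log (L (s ^ κ)) := by
      intro s hs hLs
      have hs0 : 0 < s := by linarith
      rw [profileKL, if_pos (hXe.trans hs), log_mul (by positivity) (by positivity),
        log_mul (by positivity) (by positivity), log_rpow hs0, log_rpow hLs]
    have hP := hX _ hRκ _ hrκ
    rw [log_rpow hr0, log_rpow hR0, ← mul_sub, ← log_div hr0.ne' hR0.ne', abs_mul,
      abs_of_pos (by linarith : 0 < κ)] at hP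
    have hτ0 : 0 ≤ 1 / (κ / (κ - 1)) := by
      have : 0 < κ - 1 := by linarith
      positivity
    have hτ1 : 1 / (κ / (κ - 1)) ≤ 1 := by
      rw [one_div_div, div_le_one (by linarith)]; linarith
    have hb : ε / κ * (1 + κ * |log (r / R)|) ≤ ε + ε * |log (r / R)| := by
      have : ε / κ ≤ ε := div_le_self hε.le hκ.le
      have h2 : ε / κ * (1 + κ * |log (r / R)|) = ε / κ + ε * |log (r / R)| := by field_simp
      linarith
    have hτ : -(ε + ε * |log (r / R)|)
        ≤ 1 / (κ / (κ - 1)) * (log (L (r ^ κ)) - log (L (R ^ κ))) := by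
      refine (abs_le.1 ?_).1
      rw [abs_mul, abs_of_nonneg hτ0]
      exact (mul_le_of_le_one_left (abs_nonneg _) hτ1).trans (hP.trans hb)
    rw [← log_le_log_iff (by positivity) hgr, log_mul (exp_pos _).ne' hgR.ne', log_exp,
      hlog r hr hLr, hlog R hR hLR, log_div hr0.ne' hR0.ne']
    rw [log_div hr0.ne' hR0.ne'] at hτ
    linarith

/-! ### Tangent inequalities and slopes -/

/-- The power `c u ^ p` lies above its tangent line of slope `k`. -/
theorem mul_sub_le_mul_rpow {c p k u : ℝ} (hc : 0 < c) (hp : 1 < p) (hk : 0 < k) (hu : 0 ≤ u) :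
    k * u - k * (k / (c * p)) ^ (1 / (p - 1)) * ((p - 1) / p) ≤ c * u ^ p := by
  have hp0 : 0 < p := by linarith
  have hp1 : 0 < p - 1 := by linarith
  -- `s` is the point where the derivative of `c u ^ p` equals `k`; the claim is Bernoulli's
  -- inequality at `u / s`.
  set s := (k / (c * p)) ^ (1 / (p - 1)) with hs
  have hs0 : 0 < s := by positivity
  have hsp : s ^ (p - 1) = k / (c * p) := by
    rw [hs, ← rpow_mul (by positivity), one_div_mul_cancel hp1.ne', rpow_one]
  have hsp' : c * s ^ p = k * s / p := by
    have : s ^ p = s ^ (p - 1) * s := by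
      rw [← rpow_add_one hs0.ne']; ring_nf
    rw [this, hsp]; field_simp
  have hb := one_add_mul_self_le_rpow_one_add (s := u / s - 1)
    (by have : 0 ≤ u / s := by positivity
        linarith) hp.le
  rw [show 1 + (u / s - 1) = u / s by ring, div_rpow hu hs0.le] at hb
  have h2 : c * s ^ p * (1 + p * (u / s - 1)) ≤ c * s ^ p * (u ^ p / s ^ p) := by gcongr
  have h3 : c * s ^ p * (u ^ p / s ^ p) = c * u ^ p := by
    have : s ^ p ≠ 0 := by positivity
    field_simp
  rw [h3, hsp'] at h2
  refine le_trans (le_of_eq ?_) h2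
  field_simp
  ring

/-- The right side is `exp (-2 * ε) * u ^ (κ + η)`, with `η = -ε` for `u ≥ 1` and `η = ε` for `u ≤
1`. `G η` is the intercept, up to sign, of its tangent of slope `κ`, and tends to `κ - 1` as `η →
0`. -/
theorem exists_tangent_le {κ δ : ℝ} (hκ : 1 < κ) (hδ : 0 < δ) :
    ∃ ε > 0, ∀ u, 0 < u →
      κ * u - (κ - 1) - δ ≤ exp (-ε) * exp (κ * log u - ε - ε * |log u|) := by
  let G : ℝ → ℝ := fun η =>
    κ * (κ / (exp (-2 * |η|) * (κ + η))) ^ (1 / (κ + η - 1)) * ((κ + η - 1) / (κ + η))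
  have hG : ContinuousAt G 0 := by
    have h1 : ContinuousAt (fun η : ℝ => κ / (exp (-2 * |η|) * (κ + η))) 0 := by
      refine ContinuousAt.div (by fun_prop) (by fun_prop) ?_
      simp; linarith
    have h2 : ContinuousAt (fun η : ℝ => 1 / (κ + η - 1)) 0 := by
      refine ContinuousAt.div (by fun_prop) (by fun_prop) ?_
      simp; linarith
    have h3 : ContinuousAt (fun η : ℝ => (κ + η - 1) / (κ + η)) 0 := by
      refine ContinuousAt.div (by fun_prop) (by fun_prop) ?_
      simp; linarith
    exact (continuousAt_const.mul (h1.rpow h2 (Or.inl (by simp; linarith)))).mul h3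
  have hG0 : G 0 = κ - 1 := by
    have : κ ≠ 0 := by linarith
    simp only [G]
    simp [div_self this]
    field_simp
  have hev : ∀ᶠ η in 𝓝 (0 : ℝ), G η < κ - 1 + δ :=
    hG.eventually_lt continuousAt_const (by rw [hG0]; linarith)
  obtain ⟨r, hr, hball⟩ := Metric.eventually_nhds_iff.1 hev
  have hε : 0 < min (r / 2) ((κ - 1) / 2) := lt_min (by linarith) (by linarith)
  set ε := min (r / 2) ((κ - 1) / 2)
  have hεr : ε < r := (min_le_left _ _).trans_lt (by linarith)
  have hεκ : ε < κ - 1 := (min_le_right _ _).trans_lt (by linarith)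
  have key : ∀ η, |η| = ε → ∀ u, 0 < u → κ * u - (κ - 1) - δ ≤ exp (-2 * ε) * u ^ (κ + η) := by
    intro η hη u hu
    have h1 : G η < κ - 1 + δ := hball (by simpa [hη] using hεr)
    have h2 := neg_abs_le η
    have h3 := mul_sub_le_mul_rpow (c := exp (-2 * |η|)) (p := κ + η) (k := κ) (exp_pos _)
      (by linarith) (by linarith) hu.le
    change κ * u - G η ≤ _ at h3
    rw [hη] at h3
    linarith
  refine ⟨ε, hε, fun u hu => ?_⟩
  rcases le_total 0 (log u) with h | h
  · refine (key (-ε) (by rw [abs_neg, abs_of_pos hε]) u hu).trans (le_of_eq ?_)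
    rw [rpow_def_of_pos hu, abs_of_nonneg h, ← exp_add, ← exp_add]; congr 1; ring
  · refine (key ε (abs_of_pos hε) u hu).trans (le_of_eq ?_)
    rw [rpow_def_of_pos hu, abs_of_nonpos h, ← exp_add, ← exp_add]; congr 1; ring

namespace IsRegularProfile

variable {κ : ℝ} {g : ℝ → ℝ}

/-- The profile lies, up to a small error, above the tangent line with slope `κ g(R) / R`. -/
theorem tangent_le (hg : IsRegularProfile κ g) (hκ : 1 < κ) {δ : ℝ} (hδ : 0 < δ) :
    ∃ a, 0 < a ∧ a < 1 ∧ ∃ X > 0, ∀ r ≥ X, ∀ R ≥ X,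
      (κ * (r / R) - (κ - 1) - δ) * g R ≤ a * g r := by
  obtain ⟨ε, hε, h⟩ := exists_tangent_le hκ hδ
  obtain ⟨X, hX, hP⟩ := hg.potter ε hε
  obtain ⟨b, hb, hpos⟩ := hg.eventually_pos
  -- The spare factor `a < 1` is what the converse later loses when it bounds the intercept of an
  -- affine minorant.
  refine ⟨exp (-ε), exp_pos _, by simpa using hε, max X b, lt_max_of_lt_left hX,
    fun r hr R hR => ?_⟩
  have hr0 : 0 < r := hX.trans_le ((le_max_left _ _).trans hr)
  have hR0 : 0 < R := hX.trans_le ((le_max_left _ _).trans hR)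
  have hgR := hpos R ((le_max_right _ _).trans hR)
  calc _ ≤ exp (-ε) * exp (κ * log (r / R) - ε - ε * |log (r / R)|) * g R := by
        gcongr; exact h _ (by positivity)
    _ ≤ exp (-ε) * g r := by
        rw [mul_assoc]
        gcongr
        exact hP r ((le_max_left _ _).trans hr) R ((le_max_left _ _).trans hR)

theorem tendsto_div_atTop (hg : IsRegularProfile κ g) (hκ : 1 < κ) :
    Tendsto (fun r => g r / r) atTop atTop := by
  -- With this choice `κ - ε = 1 + ε`, so `g` grows at least like `r ^ (1 + ε)`.
  set ε := (κ - 1) / 2 with hε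
  have hε0 : 0 < ε := by linarith
  obtain ⟨X, hX, hP⟩ := hg.potter ε hε0
  obtain ⟨b, hb, hpos⟩ := hg.eventually_pos
  set R := max X b
  have hR0 : 0 < R := lt_max_of_lt_left hX
  have hgR : 0 < g R := hpos R (le_max_right _ _)
  have hlim : Tendsto (fun r : ℝ => r ^ ε * (exp (-ε) * (R ^ (1 + ε))⁻¹ * g R)) atTop atTop :=
    (tendsto_rpow_atTop hε0).atTop_mul_const (by positivity)
  refine tendsto_atTop_mono' _ ?_ hlim
  filter_upwards [eventually_ge_atTop R] with r hr
  have hr0 : 0 < r := hR0.trans_le hr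
  have h := hP r ((le_max_left _ _).trans hr) R (le_max_left _ _)
  have hlog : 0 ≤ log (r / R) := log_nonneg (by rwa [one_le_div hR0])
  rw [abs_of_nonneg hlog, show κ * log (r / R) - ε - ε * log (r / R)
    = -ε + log (r / R) * (1 + ε) by rw [hε]; ring, exp_add, ← rpow_def_of_pos (by positivity),
    div_rpow hr0.le hR0.le, rpow_add hr0, rpow_one] at h
  rw [le_div_iff₀ hr0]
  refine le_trans (le_of_eq ?_) h
  field_simp

theorem tendsto_atTop (hg : IsRegularProfile κ g) (hκ : 1 < κ) : Tendsto g atTop atTop := by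
  refine ((hg.tendsto_div_atTop hκ).atTop_mul_atTop₀ tendsto_id).congr' ?_
  filter_upwards [eventually_gt_atTop 0] with r hr
  simp [div_mul_cancel₀ _ hr.ne']

theorem eventually_mul_le (hg : IsRegularProfile κ g) (hκ : 1 < κ) (A : ℝ) {δ : ℝ} (hδ : 0 < δ) :
    ∀ᶠ r in atTop, A * r ≤ δ * g r := by
  filter_upwards [(hg.tendsto_div_atTop hκ).eventually_ge_atTop (A / δ), eventually_gt_atTop 0]
    with r h hr
  rwa [div_le_div_iff₀ hδ hr, mul_comm (g r)] at h

theorem eventually_mul_div_le (hg : IsRegularProfile κ g) (hκ : 1 < κ) (A : ℝ) {δ : ℝ}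
    (hδ : 0 < δ) : ∀ᶠ r in atTop, A * (g r / r) ≤ δ * g r := by
  filter_upwards [(hg.tendsto_atTop hκ).eventually_ge_atTop 0, eventually_gt_atTop 0,
    eventually_ge_atTop (A / δ)] with r h hr hrA
  rw [div_le_iff₀ hδ] at hrA
  rw [← mul_div_assoc, div_le_iff₀ hr]
  nlinarith

/-- Upper bound for the Young–Fenchel transform of the profile at `κ g(R) / R`. -/
theorem eventually_forall_mul_sub_le (hg : IsRegularProfile κ g) (hκ : 1 < κ) {δ : ℝ}
    (hδ : 0 < δ) :
    ∀ᶠ R in atTop, ∀ r, 0 ≤ r → r * (κ * (g R / R)) - g r ≤ (κ - 1 + δ) * g R := by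
  obtain ⟨a, ha, ha1, X, hX, h⟩ := hg.tangent_le hκ hδ
  obtain ⟨b, hb, hpos⟩ := hg.eventually_pos
  obtain ⟨B, hB⟩ := hg.bddBelow
  have hκ1 : 0 < (κ - 1) / 2 := by linarith
  filter_upwards [eventually_ge_atTop (max X b),
    hg.eventually_mul_div_le hκ (max X b * κ) hκ1,
    (hg.tendsto_atTop hκ).eventually_ge_atTop (B / ((κ - 1) / 2))] with R hR hsmall hBR r hr
  have hR0 : 0 < R := hX.trans_le ((le_max_left _ _).trans hR)
  have hgR := hpos R ((le_max_right _ _).trans hR)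
  rcases le_total (max X b) r with hrX | hrX
  · have h1 := h r ((le_max_left _ _).trans hrX) R ((le_max_left _ _).trans hR)
    have hgr := hpos r ((le_max_right _ _).trans hrX)
    have h2 : a * g r ≤ g r := mul_le_of_le_one_left hgr.le ha1.le
    have h3 : r * (κ * (g R / R)) = κ * (r / R) * g R := by ring
    rw [h3]; linarith
  -- Potter bounds say nothing for bounded `r`, but there the linear term is `o(g R)` and `g` is
  -- bounded below.
  · have h1 : r * (κ * (g R / R)) ≤ max X b * κ * (g R / R) := by
      rw [mul_assoc]; gcongr
    rw [div_le_iff₀ hκ1] at hBR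
    have := hB r hr
    have : 0 < δ * g R := by positivity
    linarith

/-- The profile changes little under small dilations of the argument. -/
theorem exists_mul_le_div (hg : IsRegularProfile κ g) (hκ : 1 < κ) {b : ℝ} (hb : b < 1) :
    ∃ q > 1, ∀ᶠ r in atTop, b * g r ≤ g (r / q) := by
  have hlim : Tendsto (fun ε : ℝ => exp (κ * -ε - ε - ε * ε)) (𝓝[>] 0) (𝓝 1) := by
    have : ContinuousAt (fun ε : ℝ => exp (κ * -ε - ε - ε * ε)) 0 := by fun_prop
    simpa using (this.tendsto.mono_left (nhdsWithin_le_nhds (s := Set.Ioi 0)))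
  obtain ⟨ε, hεb, hε⟩ := ((hlim.eventually (lt_mem_nhds hb)).and self_mem_nhdsWithin).exists
  have hε : 0 < ε := hε
  obtain ⟨X, hX, hP⟩ := hg.potter ε hε
  refine ⟨exp ε, one_lt_exp_iff.2 hε, ?_⟩
  filter_upwards [eventually_ge_atTop X, eventually_ge_atTop (X * exp ε),
    (hg.tendsto_atTop hκ).eventually_ge_atTop 0] with r hr hr' hgr
  have hr0 : 0 < r := hX.trans_le hr
  have h := hP (r / exp ε) (by rwa [ge_iff_le, le_div_iff₀ (exp_pos _)]) r hr
  have hdiv : r / exp ε / r = exp (-ε) := by rw [exp_neg]; field_simp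
  rw [hdiv, log_exp, abs_neg, abs_of_pos hε] at h
  exact (mul_le_mul_of_nonneg_right hεb.le hgr).trans h

/-- Every large slope has the form `κ g(R) / R` with a large `R`. -/
theorem eventually_exists_slope (hg : IsRegularProfile κ g) (hκ : 1 < κ) {P : ℝ → Prop}
    (hP : ∀ᶠ R in atTop, P R) : ∀ᶠ t in atTop, ∃ R, P R ∧ κ * (g R / R) = t := by
  obtain ⟨a, ha⟩ := hg.continuousOn
  obtain ⟨X, hX⟩ := eventually_atTop.1 hP
  set Y := max (max a X) 1
  have hcont : ContinuousOn (fun R => κ * (g R / R)) (Set.Ici Y) := by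
    refine continuousOn_const.mul (ContinuousOn.div (ha.mono ?_) continuousOn_id ?_)
    · exact Set.Ici_subset_Ici.2 ((le_max_left _ _).trans (le_max_left _ _))
    · intro R hR
      exact (zero_lt_one.trans_le ((le_max_right _ _).trans hR)).ne'
  have hsurj := intermediate_value_Ici hcont
    ((hg.tendsto_div_atTop hκ).const_mul_atTop (by linarith : 0 < κ))
  filter_upwards [eventually_ge_atTop (κ * (g Y / Y))] with t ht
  obtain ⟨R, hR, hRt⟩ := hsurj ht
  exact ⟨R, hX R (((le_max_right _ _).trans (le_max_left _ _)).trans hR), hRt⟩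

end IsRegularProfile

/-! ### Reduction to one dimension -/

variable {d : ℕ}

theorem minCoord_le_norm (hd : 1 ≤ d) (x : EuclideanSpace ℝ (Fin d)) : minCoord x ≤ ‖x‖ := by
  have h1 : minCoord x ≤ x ⟨0, hd⟩ := ciInf_le (Set.finite_range _).bddBelow _
  exact h1.trans ((le_abs_self _).trans (by simpa using PiLp.norm_apply_le x ⟨0, hd⟩))

theorem tendsto_norm_minCoordAtTop (hd : 1 ≤ d) :
    Tendsto (fun x : EuclideanSpace ℝ (Fin d) => ‖x‖) (minCoordAtTop d) atTop :=
  tendsto_atTop_mono (minCoord_le_norm hd) tendsto_comap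

/-- There is a ray parametrized by arc length along which all coordinates tend to infinity. -/
theorem exists_ray_minCoordAtTop (hd : 1 ≤ d) : ∃ v : EuclideanSpace ℝ (Fin d), ‖v‖ = 1 ∧
    Tendsto (fun R : ℝ => R • v) atTop (minCoordAtTop d) := by
  have : Nonempty (Fin d) := ⟨⟨0, hd⟩⟩
  have hd0 : (0 : ℝ) < d := by exact_mod_cast hd
  refine ⟨WithLp.toLp 2 fun _ => (√d)⁻¹, ?_, ?_⟩
  · rw [EuclideanSpace.norm_eq]
    simp [hd0.le, hd0.ne']
  · rw [minCoordAtTop, tendsto_comap_iff]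
    refine (tendsto_id.atTop_mul_const (inv_pos.2 (sqrt_pos.2 hd0))).congr fun R => ?_
    simp [minCoord]

theorem exists_norm_eq_inner_eq (hd : 1 ≤ d) (y : EuclideanSpace ℝ (Fin d)) {r : ℝ} (hr : 0 ≤ r) :
    ∃ x : EuclideanSpace ℝ (Fin d), ‖x‖ = r ∧ inner ℝ x y = r * ‖y‖ := by
  rcases eq_or_ne y 0 with rfl | hy
  · obtain ⟨v, hv, -⟩ := exists_ray_minCoordAtTop hd
    exact ⟨r • v, by simp [norm_smul, hv, abs_of_nonneg hr], by simp⟩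
  · have hy' : ‖y‖ ≠ 0 := norm_ne_zero_iff.2 hy
    refine ⟨(r / ‖y‖) • y, ?_, ?_⟩
    · rw [norm_smul, norm_div, norm_norm, div_mul_cancel₀ _ hy', norm_of_nonneg hr]
    · rw [real_inner_smul_left, real_inner_self_eq_norm_sq]; field_simp

/-- The one-dimensional Young–Fenchel transform over the half-line. -/
def halfLineConjugate (g : ℝ → ℝ) (t : ℝ) : ℝ :=
  ⨆ r : Set.Ici (0 : ℝ), ((r : ℝ) * t - g r)

theorem forall_inner_sub_radial_le_iff (hd : 1 ≤ d) (g : ℝ → ℝ) (y : EuclideanSpace ℝ (Fin d)) {m : ℝ} :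
    (∀ x : EuclideanSpace ℝ (Fin d), inner ℝ x y - g ‖x‖ ≤ m) ↔
      ∀ r, 0 ≤ r → r * ‖y‖ - g r ≤ m := by
  refine ⟨fun h r hr => ?_, fun h x => ?_⟩
  · obtain ⟨x, rfl, hxy⟩ := exists_norm_eq_inner_eq hd y hr
    rw [← hxy]; exact h x
  · exact (sub_le_sub_right (real_inner_le_norm x y) _).trans (h _ (norm_nonneg x))

/-- Aligning `x` with `y` attains Cauchy–Schwarz, so both suprema have the same upper bounds.
Finiteness matters because an unbounded real `⨆` takes a default value. -/
theorem youngFenchel_radial (hd : 1 ≤ d) {g : ℝ → ℝ}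
    (hfin : ∀ t, ∃ m, ∀ r, 0 ≤ r → r * t - g r ≤ m) (y : EuclideanSpace ℝ (Fin d)) :
    youngFenchel (fun x => g ‖x‖) y = halfLineConjugate g ‖y‖ := by
  have hub : ∀ m, (∀ r, 0 ≤ r → r * ‖y‖ - g r ≤ m) ↔ ∀ r : Set.Ici (0 : ℝ), r * ‖y‖ - g r ≤ m :=
    fun m => by simp
  obtain ⟨m₀, hm₀⟩ := hfin ‖y‖
  have hb1 : BddAbove (Set.range fun x : EuclideanSpace ℝ (Fin d) => inner ℝ x y - g ‖x‖) :=
    ⟨m₀, by rintro _ ⟨x, rfl⟩; exact (forall_inner_sub_radial_le_iff hd g y).2 hm₀ x⟩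
  have hb2 : BddAbove (Set.range fun r : Set.Ici (0 : ℝ) => (r : ℝ) * ‖y‖ - g r) :=
    ⟨m₀, by rintro _ ⟨r, rfl⟩; exact hm₀ r r.2⟩
  refine eq_of_forall_ge_iff fun m => ?_
  rw [youngFenchel, halfLineConjugate, ciSup_le_iff hb1, ciSup_le_iff hb2, ← hub,
    forall_inner_sub_radial_le_iff hd]

theorem le_halfLineConjugate {g : ℝ → ℝ} (hfin : ∀ t, ∃ m, ∀ r, 0 ≤ r → r * t - g r ≤ m)
    {r : ℝ} (hr : 0 ≤ r) (t : ℝ) : r * t - g r ≤ halfLineConjugate g t := by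
  obtain ⟨m, hm⟩ := hfin t
  exact le_ciSup (f := fun r : Set.Ici (0 : ℝ) => (r : ℝ) * t - g r)
    ⟨m, by rintro _ ⟨r, rfl⟩; exact hm r r.2⟩ ⟨r, hr⟩

theorem halfLineConjugate_le {g : ℝ → ℝ} {t m : ℝ} (h : ∀ r, 0 ≤ r → r * t - g r ≤ m) :
    halfLineConjugate g t ≤ m := by
  have : Nonempty (Set.Ici (0 : ℝ)) := ⟨⟨0, Set.self_mem_Ici⟩⟩
  exact ciSup_le fun r => h r r.2

theorem halfLineConjugate_mono {g : ℝ → ℝ} (hfin : ∀ t, ∃ m, ∀ r, 0 ≤ r → r * t - g r ≤ m) :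
    Monotone (halfLineConjugate g) := fun _ t hst =>
  halfLineConjugate_le fun _ hr =>
    (sub_le_sub_right (mul_le_mul_of_nonneg_left hst hr) _).trans (le_halfLineConjugate hfin hr t)

/-! ### Two-sided bounds for Laplace integrals -/

theorem integrable_exp_neg_norm (d : ℕ) :
    Integrable (fun x : EuclideanSpace ℝ (Fin d) => exp (-‖x‖)) := by
  have h := (integrable_one_add_norm (E := EuclideanSpace ℝ (Fin d)) (μ := volume)
    (r := (d + 1 : ℕ)) (by simp)).const_mul (exp 1 * (d + 1).factorial)
  refine h.mono' (by fun_prop) (ae_of_all _ fun x => ?_)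
  have h1 : 0 < 1 + ‖x‖ := by positivity
  have h2 := pow_div_factorial_le_exp (1 + ‖x‖) h1.le (d + 1)
  rw [norm_of_nonneg (exp_pos _).le, rpow_neg h1.le, rpow_natCast, exp_neg,
    ← div_eq_mul_inv, inv_eq_one_div, div_le_div_iff₀ (exp_pos _) (by positivity)]
  rw [div_le_iff₀ (by positivity), exp_add] at h2
  linarith

/-- The integral of `exp (-|x|)`. -/
def expNegNormIntegral (d : ℕ) : ℝ := ∫ x : EuclideanSpace ℝ (Fin d), exp (-‖x‖)

theorem expNegNormIntegral_pos (d : ℕ) : 0 < expNegNormIntegral d :=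
  integral_exp_pos (integrable_exp_neg_norm d)

theorem laplaceIntegrand_le {f : EuclideanSpace ℝ (Fin d) → ℝ} {lam : EuclideanSpace ℝ (Fin d)}
    {ρ m : ℝ} (hρ : ‖lam‖ + 1 ≤ ρ) (hf : ∀ x, ρ * ‖x‖ - m ≤ f x) (x : EuclideanSpace ℝ (Fin d)) :
    laplaceIntegrand f lam x ≤ exp m * exp (-‖x‖) := by
  rw [laplaceIntegrand, ← exp_add, exp_le_exp]
  have h1 := real_inner_le_norm lam x
  have h2 := hf x
  have h3 := mul_le_mul_of_nonneg_right hρ (norm_nonneg x)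
  linarith

theorem integrable_laplaceIntegrand {f : EuclideanSpace ℝ (Fin d) → ℝ}
    {lam : EuclideanSpace ℝ (Fin d)} (hmeas : Measurable f) {ρ m : ℝ} (hρ : ‖lam‖ + 1 ≤ ρ)
    (hf : ∀ x, ρ * ‖x‖ - m ≤ f x) : Integrable (laplaceIntegrand f lam) := by
  refine ((integrable_exp_neg_norm d).const_mul (exp m)).mono' ?_ (ae_of_all _ fun x => ?_)
  · unfold laplaceIntegrand
    exact (by fun_prop : Measurable _).aestronglyMeasurable
  · exact (norm_of_nonneg (exp_pos _).le).trans_le (laplaceIntegrand_le hρ hf x)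

theorem laplaceIntegral_le {f : EuclideanSpace ℝ (Fin d) → ℝ} {lam : EuclideanSpace ℝ (Fin d)}
    {ρ m : ℝ} (hρ : ‖lam‖ + 1 ≤ ρ) (hf : ∀ x, ρ * ‖x‖ - m ≤ f x) :
    laplaceIntegral f lam ≤ exp m * expNegNormIntegral d := by
  rw [laplaceIntegral, expNegNormIntegral, ← integral_const_mul]
  exact integral_mono_of_nonneg (ae_of_all _ fun x => (exp_pos _).le)
    ((integrable_exp_neg_norm d).const_mul _) (ae_of_all _ (laplaceIntegrand_le hρ hf))

/-- The volume of the unit ball. -/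
def unitBallVolume (d : ℕ) : ℝ := volume.real (Metric.closedBall (0 : EuclideanSpace ℝ (Fin d)) 1)

theorem unitBallVolume_pos (d : ℕ) : 0 < unitBallVolume d :=
  ENNReal.toReal_pos (Metric.measure_closedBall_pos _ _ one_pos).ne' measure_closedBall_lt_top.ne

/-- The unit ball centred at distance `t - 1` along `lam` stays within radius `t`, where `ψ ≤ ψ t`.
The recentring and the radius each cost at most `‖lam‖` in the exponent. -/
theorem le_laplaceIntegral_radial (hd : 1 ≤ d) {ψ : ℝ → ℝ} (hψ : MonotoneOn ψ (Set.Ici 0))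
    {lam : EuclideanSpace ℝ (Fin d)}
    (hint : Integrable (laplaceIntegrand (fun x : EuclideanSpace ℝ (Fin d) => ψ ‖x‖) lam))
    {t : ℝ} (ht : 1 ≤ t) :
    unitBallVolume d * exp (‖lam‖ * t - ψ t - 2 * ‖lam‖) ≤
      laplaceIntegral (fun x : EuclideanSpace ℝ (Fin d) => ψ ‖x‖) lam := by
  obtain ⟨x₀, hx₀, hin⟩ := exists_norm_eq_inner_eq hd lam (sub_nonneg.2 ht)
  have hvol : unitBallVolume d = volume.real (Metric.closedBall x₀ 1) := by
    simp only [unitBallVolume, Measure.real]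
    rw [Measure.addHaar_closedBall_center volume x₀]
  calc _ = ∫ _ in Metric.closedBall x₀ 1, exp (‖lam‖ * t - ψ t - 2 * ‖lam‖) := by
        rw [setIntegral_const, hvol, smul_eq_mul]
    _ ≤ ∫ x in Metric.closedBall x₀ 1,
          laplaceIntegrand (fun x : EuclideanSpace ℝ (Fin d) => ψ ‖x‖) lam x := by
        refine setIntegral_mono_on (integrableOn_const measure_closedBall_lt_top.ne)
          hint.integrableOn Metric.isClosed_closedBall.measurableSet fun x hx => ?_
        rw [mem_closedBall_iff_norm] at hx
        rw [laplaceIntegrand, exp_le_exp]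
        have h1 : ‖x‖ ≤ t := by
          have := norm_add_le (x - x₀) x₀
          rw [sub_add_cancel, hx₀] at this
          linarith
        have h2 : ψ ‖x‖ ≤ ψ t := hψ (norm_nonneg x) (by simp; linarith) h1
        have h3 : -‖lam‖ ≤ inner ℝ lam (x - x₀) := by
          have h4 := (abs_le.1 (abs_real_inner_le_norm lam (x - x₀))).1
          have h5 : ‖lam‖ * ‖x - x₀‖ ≤ ‖lam‖ := mul_le_of_le_one_right (norm_nonneg _) hx
          linarith
        rw [inner_sub_right, real_inner_comm x₀ lam, hin] at h3
        linarith
    _ ≤ _ := setIntegral_le_integral hint (ae_of_all _ fun x => (exp_pos _).le)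

/-! ### Young–Orlicz functions and ratio limits -/

theorem IsYoungOrlicz.nonneg {φ : ℝ → ℝ} (hφ : IsYoungOrlicz φ) (t : ℝ) : 0 ≤ φ t := by
  have h := hφ.convex.2 (Set.mem_univ t) (Set.mem_univ (-t)) 
    (by norm_num : (0 : ℝ) ≤ 1 / 2) (by norm_num : (0 : ℝ) ≤ 1 / 2) (by norm_num)
  simp only [smul_eq_mul, hφ.even] at h
  rw [show 1 / 2 * t + 1 / 2 * -t = (0 : ℝ) by ring, hφ.zero] at h
  linarith

theorem IsYoungOrlicz.monotoneOn {φ : ℝ → ℝ} (hφ : IsYoungOrlicz φ) :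
    MonotoneOn φ (Set.Ici 0) := by
  intro s hs t ht hst
  rcases eq_or_lt_of_le (show (0 : ℝ) ≤ t from ht) with h | h
  · have : s = t := le_antisymm hst (h ▸ hs)
    rw [this]
  have hs' : (0 : ℝ) ≤ s := hs
  have hle : s / t ≤ 1 := (div_le_one h).2 hst
  have h0 : 0 ≤ s / t := by positivity
  have hc := hφ.convex.2 (Set.mem_univ 0) (Set.mem_univ t) (sub_nonneg.2 hle) h0 (by ring)
  simp only [smul_eq_mul, mul_zero, zero_add, hφ.zero, div_mul_cancel₀ _ h.ne'] at hc
  exact hc.trans (mul_le_of_le_one_left (hφ.nonneg t) hle)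

theorem tendsto_div_one_of_eventually_bounds {α : Type*} {l : Filter α} {F G : α → ℝ}
    (h : ∀ δ, 0 < δ → δ < 1 → ∀ᶠ x in l, 0 < G x ∧ (1 - δ) * G x ≤ F x ∧ F x ≤ (1 + δ) * G x) :
    Tendsto (fun x => F x / G x) l (𝓝 1) := by
  rw [Metric.tendsto_nhds]
  intro ε hε
  have hpos : 0 < min (ε / 2) (1 / 2) := by positivity
  filter_upwards [h _ hpos ((min_le_right _ _).trans_lt (by norm_num))] with x ⟨h0, h1, h2⟩
  rw [← le_div_iff₀ h0] at h1
  rw [← div_le_iff₀ h0] at h2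
  have := min_le_left (ε / 2) (1 / 2)
  rw [Real.dist_eq, abs_lt]
  constructor <;> linarith

theorem eventually_bounds_of_tendsto_div_one {α : Type*} {l : Filter α} {F G : α → ℝ}
    (h : Tendsto (fun x => F x / G x) l (𝓝 1)) (hG : ∀ᶠ x in l, 0 < G x) {δ : ℝ} (hδ : 0 < δ) :
    ∀ᶠ x in l, (1 - δ) * G x ≤ F x ∧ F x ≤ (1 + δ) * G x := by
  filter_upwards [hG, h.eventually (eventually_ge_nhds (show 1 - δ < 1 by linarith)),
    h.eventually (eventually_le_nhds (show 1 < 1 + δ by linarith))] with x h0 h1 h2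
  exact ⟨(le_div_iff₀ h0).1 h1, (div_le_iff₀ h0).1 h2⟩

/-! ### Direct part -/

namespace IsRegularProfile

variable {κ : ℝ} {g : ℝ → ℝ}

theorem exists_forall_mul_sub_le (hg : IsRegularProfile κ g) (hκ : 1 < κ) (t : ℝ) :
    ∃ m, ∀ r, 0 ≤ r → r * t - g r ≤ m := by
  obtain ⟨R, hR, ht⟩ := ((hg.eventually_forall_mul_sub_le hκ one_pos).and
    (((hg.tendsto_div_atTop hκ).const_mul_atTop
      (by linarith : 0 < κ)).eventually_ge_atTop t)).exists
  exact ⟨_, fun r hr =>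
    (sub_le_sub_right (mul_le_mul_of_nonneg_left ht hr) _).trans (hR r hr)⟩

theorem eventually_halfLineConjugate_le (hg : IsRegularProfile κ g) (hκ : 1 < κ) {δ : ℝ}
    (hδ : 0 < δ) :
    ∀ᶠ R in atTop, halfLineConjugate g (κ * (g R / R)) ≤ (κ - 1 + δ) * g R := by
  filter_upwards [hg.eventually_forall_mul_sub_le hκ hδ] with R hR
  exact halfLineConjugate_le hR

theorem le_halfLineConjugate_slope (hg : IsRegularProfile κ g) (hκ : 1 < κ) {R : ℝ}
    (hR : 0 < R) : (κ - 1) * g R ≤ halfLineConjugate g (κ * (g R / R)) := by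
  refine le_trans (le_of_eq ?_) (le_halfLineConjugate (hg.exists_forall_mul_sub_le hκ) hR.le _)
  field_simp

theorem integrable_laplaceIntegrand_halfLineConjugate (hg : IsRegularProfile κ g) (hκ : 1 < κ)
    (lam : EuclideanSpace ℝ (Fin d)) : Integrable
      (laplaceIntegrand (fun x : EuclideanSpace ℝ (Fin d) => halfLineConjugate g ‖x‖) lam) :=
  have hfin := hg.exists_forall_mul_sub_le hκ
  integrable_laplaceIntegrand ((halfLineConjugate_mono hfin).measurable.comp measurable_norm)
    le_rfl fun _ => le_halfLineConjugate hfin (by positivity) _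

theorem eventually_log_laplaceIntegral_le (hg : IsRegularProfile κ g) (hκ : 1 < κ) {δ : ℝ}
    (hδ : 0 < δ) : ∀ᶠ R in atTop, ∀ lam : EuclideanSpace ℝ (Fin d), ‖lam‖ = R →
      log (laplaceIntegral (fun x : EuclideanSpace ℝ (Fin d) => halfLineConjugate g ‖x‖) lam)
        ≤ (1 + δ) * g R := by
  have hδ2 : 0 < 1 + δ / 2 := by linarith
  -- Used at `q * R` this reads `g (q * R) ≤ (1 + δ / 2) * g R`; the other `δ / 2` absorbs the
  -- constant, and `R ≥ 1 / (q - 1)` ensures `R + 1 ≤ q * R`.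
  obtain ⟨q, hq, hqg⟩ := hg.exists_mul_le_div hκ (b := 1 / (1 + δ / 2))
    (by rw [div_lt_one hδ2]; linarith)
  have hq0 : 0 < q := by linarith
  have hq1 : 0 < q - 1 := by linarith
  filter_upwards [(tendsto_id.const_mul_atTop hq0).eventually hqg,
    eventually_ge_atTop (1 / (q - 1)),
    (hg.tendsto_atTop hκ).eventually_ge_atTop (log (expNegNormIntegral d) / (δ / 2))]
    with R hRq hR hgR lam hlam
  rw [div_le_iff₀ hq1] at hR
  rw [div_le_iff₀ (by positivity)] at hgR
  simp only [id, mul_div_cancel_left₀ _ hq0.ne'] at hRq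
  rw [one_div_mul_eq_div, div_le_iff₀ hδ2] at hRq
  have hR0 : 0 ≤ R := hlam ▸ norm_nonneg lam
  have hle := laplaceIntegral_le (f := fun x : EuclideanSpace ℝ (Fin d) => halfLineConjugate g ‖x‖)
    (lam := lam) (ρ := q * R) (m := g (q * R)) (by rw [hlam]; linarith)
    fun x => le_halfLineConjugate (hg.exists_forall_mul_sub_le hκ) (by positivity) _
  have hpos := integral_exp_pos (hg.integrable_laplaceIntegrand_halfLineConjugate hκ lam)
  have hlog := log_le_log hpos hle
  rw [log_mul (exp_pos _).ne' (expNegNormIntegral_pos d).ne', log_exp] at hlog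
  change log (laplaceIntegral _ _) ≤ _ at hlog
  linarith

theorem eventually_le_log_laplaceIntegral (hd : 1 ≤ d) (hg : IsRegularProfile κ g) (hκ : 1 < κ)
    {δ : ℝ} (hδ : 0 < δ) : ∀ᶠ R in atTop, ∀ lam : EuclideanSpace ℝ (Fin d), ‖lam‖ = R →
      (1 - δ) * g R ≤
        log (laplaceIntegral (fun x : EuclideanSpace ℝ (Fin d) => halfLineConjugate g ‖x‖) lam) := by
  have hδ3 : 0 < δ / 3 := by positivity
  filter_upwards [hg.eventually_halfLineConjugate_le hκ hδ3, hg.eventually_mul_le hκ 2 hδ3,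
    (hg.tendsto_atTop hκ).eventually_ge_atTop (-log (unitBallVolume d) / (δ / 3)),
    ((hg.tendsto_div_atTop hκ).const_mul_atTop (by linarith : 0 < κ)).eventually_ge_atTop 1,
    eventually_gt_atTop 0] with R hconj h2R hvol ht hR lam hlam
  have h := le_laplaceIntegral_radial hd
    ((halfLineConjugate_mono (hg.exists_forall_mul_sub_le hκ)).monotoneOn _)
    (hg.integrable_laplaceIntegrand_halfLineConjugate hκ lam) ht
  have hlog := log_le_log (mul_pos (unitBallVolume_pos d) (exp_pos _)) h
  rw [log_mul (unitBallVolume_pos d).ne' (exp_pos _).ne', log_exp, hlam,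
    show R * (κ * (g R / R)) = κ * g R by field_simp] at hlog
  rw [div_le_iff₀ hδ3] at hvol
  linarith

theorem tendsto_log_laplaceIntegral_div (hd : 1 ≤ d) (hg : IsRegularProfile κ g) (hκ : 1 < κ) :
    Tendsto (fun lam : EuclideanSpace ℝ (Fin d) =>
      log (laplaceIntegral (fun x : EuclideanSpace ℝ (Fin d) => halfLineConjugate g ‖x‖) lam)
        / g ‖lam‖) (minCoordAtTop d) (𝓝 1) := by
  refine tendsto_div_one_of_eventually_bounds fun δ hδ _ => ?_
  filter_upwards [(tendsto_norm_minCoordAtTop hd).eventually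
      ((hg.tendsto_atTop hκ).eventually_gt_atTop 0),
    (tendsto_norm_minCoordAtTop hd).eventually (hg.eventually_log_laplaceIntegral_le hκ hδ),
    (tendsto_norm_minCoordAtTop hd).eventually (hg.eventually_le_log_laplaceIntegral hd hκ hδ)]
    with lam h0 h1 h2
  exact ⟨h0, h2 lam rfl, h1 lam rfl⟩

/-! ### Converse part -/

section Converse

variable {φ : ℝ → ℝ} {v : EuclideanSpace ℝ (Fin d)}

theorem eventually_le_of_log_laplaceIntegral_le (hd : 1 ≤ d) (hg : IsRegularProfile κ g)
    (hκ : 1 < κ) (hφ : IsYoungOrlicz φ) (hv : ‖v‖ = 1)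
    (hK : Tendsto (fun R : ℝ =>
      log (laplaceIntegral (fun x : EuclideanSpace ℝ (Fin d) => φ ‖x‖) (R • v)) / g R)
      atTop (𝓝 1)) {δ : ℝ} (hδ : 0 < δ) :
    ∀ᶠ R in atTop, (κ - 1 - δ) * g R ≤ φ (κ * (g R / R)) := by
  have hδ3 : 0 < δ / 3 := by positivity
  have hgpos := (hg.tendsto_atTop hκ).eventually_gt_atTop 0
  filter_upwards [hgpos, hg.eventually_mul_le hκ 2 hδ3,
    eventually_bounds_of_tendsto_div_one hK hgpos hδ3,
    eventually_bounds_of_tendsto_div_one hK hgpos one_half_pos,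
    (hg.tendsto_atTop hκ).eventually_ge_atTop (-log (unitBallVolume d) / (δ / 3)),
    ((hg.tendsto_div_atTop hκ).const_mul_atTop (by linarith : 0 < κ)).eventually_ge_atTop 1,
    eventually_gt_atTop 0] with R hgR h2R hKR hKR' hvol ht hR
  have hint : Integrable
      (laplaceIntegrand (fun x : EuclideanSpace ℝ (Fin d) => φ ‖x‖) (R • v)) := by
    -- A divergent integral has default value 0 with `log 0 = 0`, contradicting the lower bound `g R
    -- / 2 > 0`.
    by_contra hni
    have h0 := hKR'.1
    rw [laplaceIntegral, integral_undef hni, log_zero] at h0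
    linarith
  have hlog := log_le_log (mul_pos (unitBallVolume_pos d) (exp_pos _))
    (le_laplaceIntegral_radial hd hφ.monotoneOn hint ht)
  rw [log_mul (unitBallVolume_pos d).ne' (exp_pos _).ne', log_exp, norm_smul, hv, mul_one,
    norm_of_nonneg hR.le, show R * (κ * (g R / R)) = κ * g R by field_simp] at hlog
  rw [div_le_iff₀ hδ3] at hvol
  linarith [hKR.2]

/-- An affine minorant of slope `r` bounds the integral at radius `r / q` by `exp m` times a
constant, while `hK` keeps its logarithm near `g (r / q)`, itself close to `g r`. -/
theorem eventually_forall_affine_le_imp (hg : IsRegularProfile κ g) (hκ : 1 < κ) (hv : ‖v‖ = 1)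
    (hK : Tendsto (fun R : ℝ =>
      log (laplaceIntegral (fun x : EuclideanSpace ℝ (Fin d) => φ ‖x‖) (R • v)) / g R)
      atTop (𝓝 1)) {a : ℝ} (ha0 : 0 < a) (ha : a < 1) :
    ∀ᶠ r in atTop, ∀ m, (∀ s, r * s - m ≤ φ s) → a * g r ≤ m := by
  -- One factor `b` is lost in `hK`, another in the dilation by `q`; the surplus `b * b - a > 0`
  -- absorbs the constant.
  set b := (1 + a) / 2 with hb
  have hb0 : 0 < b := by positivity
  have hb1 : b < 1 := by linarith
  have hba : 0 < b * b - a := by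
    have : b * b - a = ((1 - a) / 2) ^ 2 := by rw [hb]; ring
    rw [this]
    have : 0 < 1 - a := by linarith
    positivity
  obtain ⟨q, hq, hqg⟩ := hg.exists_mul_le_div hκ hb1
  have hq0 : 0 < q := by linarith
  have hdiv : Tendsto (fun r : ℝ => r / q) atTop atTop := tendsto_id.atTop_div_const hq0
  have hgpos := (hg.tendsto_atTop hκ).eventually_gt_atTop 0
  filter_upwards [hqg,
    hdiv.eventually (eventually_bounds_of_tendsto_div_one hK hgpos (sub_pos.2 hb1)),
    hdiv.eventually hgpos,
    (hg.tendsto_atTop hκ).eventually_ge_atTop (log (expNegNormIntegral d) / (b * b - a)),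
    eventually_ge_atTop (q / (q - 1))] with r h1 h2 h3 h4 h5 m hm
  have hr0 : 0 < r := lt_of_lt_of_le (div_pos hq0 (by linarith)) h5
  rw [div_le_iff₀ (by linarith)] at h5
  have hnorm : ‖(r / q) • v‖ + 1 ≤ r := by
    rw [norm_smul, hv, mul_one, norm_of_nonneg (by positivity), div_add_one hq0.ne',
      div_le_iff₀ hq0]
    linarith
  have hle := laplaceIntegral_le (f := fun x : EuclideanSpace ℝ (Fin d) => φ ‖x‖) hnorm
    fun x => hm ‖x‖
  have hK1 := h2.1
  rw [sub_sub_cancel] at hK1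
  have hlogpos := (mul_pos hb0 h3).trans_le hK1
  have hpos : 0 < laplaceIntegral (fun x : EuclideanSpace ℝ (Fin d) => φ ‖x‖) ((r / q) • v) := by
    refine lt_of_le_of_ne (integral_nonneg fun _ => (exp_pos _).le) fun h => ?_
    rw [← h, log_zero] at hlogpos
    exact hlogpos.false
  have hlog := log_le_log hpos hle
  rw [log_mul (exp_pos _).ne' (expNegNormIntegral_pos d).ne', log_exp] at hlog
  rw [div_le_iff₀ hba] at h4
  have := mul_le_mul_of_nonneg_left h1 hb0.le
  linarith

theorem eventually_le_of_le_log_laplaceIntegral (hg : IsRegularProfile κ g)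
    (hκ : 1 < κ) (hφ : IsYoungOrlicz φ) (hv : ‖v‖ = 1)
    (hK : Tendsto (fun R : ℝ =>
      log (laplaceIntegral (fun x : EuclideanSpace ℝ (Fin d) => φ ‖x‖) (R • v)) / g R)
      atTop (𝓝 1)) {δ : ℝ} (hδ : 0 < δ) :
    ∀ᶠ R in atTop, φ (κ * (g R / R)) ≤ (κ - 1 + δ) * g R := by
  have hδ2 : 0 < δ / 2 := by positivity
  obtain ⟨a, ha0, ha1, X, hX, htan⟩ := hg.tangent_le hκ hδ2
  obtain ⟨Y, hY⟩ := eventually_atTop.1 (hg.eventually_forall_affine_le_imp hκ hv hK ha0 ha1)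
  have hcont : Continuous φ :=
    continuousOn_univ.1 (hφ.convex.continuousOn isOpen_univ)
  filter_upwards [eventually_ge_atTop X,
    (hg.tendsto_atTop hκ).eventually_ge_atTop (1 / (δ / 2)),
    hg.eventually_mul_div_le hκ (max X Y * κ) (by linarith : 0 < κ - 1)] with R hR hgR hsmall
  have hR0 : 0 < R := hX.trans_le hR
  rw [div_le_iff₀ hδ2] at hgR
  have hgpos : 0 < g R := by
    by_contra h
    nlinarith [not_lt.1 h]
  -- An affine minorant passing one below `φ` at the chosen slope; the loss of 1 is at most `δ / 2 *
  -- g R`.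
  obtain ⟨c, c', hcle, hceq⟩ := hφ.convex.exists_affine_le_of_lt_real
    (Set.mem_univ (κ * (g R / R))) (sub_one_lt (φ (κ * (g R / R)))) isClosed_univ
    (hcont.lowerSemicontinuous.lowerSemicontinuousOn _)
  rcases le_total (max X Y) c with hc | hc
  · have h1 := hY c ((le_max_right _ _).trans hc) (-c') fun s => by
      simpa using hcle s (Set.mem_univ s)
    have h2 := htan c ((le_max_left _ _).trans hc) R hR
    have h3 : c * (κ * (g R / R)) = κ * (c / R) * g R := by ring
    rw [h3] at hceq
    linarith
  -- For small `c` the value at 0 gives `c' ≤ 0`, and the linear term is `o(g R)`.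
  · have h1 := hcle 0 (Set.mem_univ 0)
    rw [hφ.zero, mul_zero, zero_add] at h1
    have h2 : c * (κ * (g R / R)) ≤ max X Y * κ * (g R / R) := by
      rw [mul_assoc]; gcongr
    linarith

theorem tendsto_radial_div_halfLineConjugate (hd : 1 ≤ d) (hg : IsRegularProfile κ g)
    (hκ : 1 < κ) (hφ : IsYoungOrlicz φ)
    (hK : Tendsto (fun lam : EuclideanSpace ℝ (Fin d) =>
      log (laplaceIntegral (fun x : EuclideanSpace ℝ (Fin d) => φ ‖x‖) lam) / g ‖lam‖)
      (minCoordAtTop d) (𝓝 1)) :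
    Tendsto (fun t => φ t / halfLineConjugate g t) atTop (𝓝 1) := by
  obtain ⟨v, hv, hray⟩ := exists_ray_minCoordAtTop hd
  have hKray : Tendsto (fun R : ℝ =>
      log (laplaceIntegral (fun x : EuclideanSpace ℝ (Fin d) => φ ‖x‖) (R • v)) / g R)
      atTop (𝓝 1) := by
    refine (hK.comp hray).congr' ?_
    filter_upwards [eventually_ge_atTop 0] with R hR
    simp [norm_smul, hv, abs_of_nonneg hR]
  have hκ1 : 0 < κ - 1 := by linarith
  refine tendsto_div_one_of_eventually_bounds fun δ hδ hδ1 => ?_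
  -- Half of the relative error `δ` of `(κ - 1) * g R` goes to `φ`, half to the conjugate.
  have hη : 0 < δ * (κ - 1) / 2 := by positivity
  refine (hg.eventually_exists_slope hκ (((eventually_gt_atTop 0).and
    ((hg.tendsto_atTop hκ).eventually_gt_atTop 0)).and
    ((hg.eventually_le_of_log_laplaceIntegral_le hd hκ hφ hv hKray hη).and
    ((hg.eventually_le_of_le_log_laplaceIntegral hκ hφ hv hKray hη).and
    (hg.eventually_halfLineConjugate_le hκ hη))))).mono ?_
  rintro _ ⟨R, ⟨⟨hR, hgR⟩, hlow, hup, hconj⟩, rfl⟩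
  have hconj' := hg.le_halfLineConjugate_slope hκ hR
  have hprod : 0 < (κ - 1) * g R := by positivity
  refine ⟨hprod.trans_le hconj', ?_, ?_⟩
  · have h1 := mul_le_mul_of_nonneg_left hconj (sub_pos.2 hδ1).le
    nlinarith [mul_pos (mul_pos hδ hδ) hprod]
  · have h1 := mul_le_mul_of_nonneg_left hconj' (by linarith : 0 ≤ 1 + δ)
    nlinarith [mul_pos hδ hprod]

end Converse

end IsRegularProfile

end

/-! ### The main theorem -/

theorem theorem7p1 (d : ℕ) (hd : 1 ≤ d) (κ : ℝ) (hκ : 1 < κ) (C : ℝ) (L : ℝ → ℝ)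
    (hL : IsSlowlyVarying L)
    (hLsmooth : ContDiffOn ℝ 2 L (Set.Ici (exp 1)))
    (hLlim : Tendsto (fun r => L r / L (r / L r)) atTop (𝓝 1)) :
    -- the transform of `zetaKL` is finite and the Laplace integral converges everywhere
    (∀ x : EuclideanSpace ℝ (Fin d), YoungFenchelFinite (zetaKL κ C L) x) ∧
    (∀ lam : EuclideanSpace ℝ (Fin d),
      Integrable (laplaceIntegrand (youngFenchel (zetaKL κ C L)) lam)) ∧
    -- direct part
    Tendsto (fun lam : EuclideanSpace ℝ (Fin d) =>
        log (laplaceIntegral (youngFenchel (zetaKL κ C L)) lam) / zetaKL κ C L lam)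
      (minCoordAtTop d) (𝓝 1) ∧
    -- converse part, for the radial function `x ↦ φ(|x|)`
    (∀ φ : ℝ → ℝ, IsYoungOrlicz φ →
      Tendsto (fun lam : EuclideanSpace ℝ (Fin d) =>
          log (laplaceIntegral (fun x : EuclideanSpace ℝ (Fin d) => φ ‖x‖) lam)
            / zetaKL κ C L lam)
        (minCoordAtTop d) (𝓝 1) →
      Tendsto (fun x : EuclideanSpace ℝ (Fin d) =>
          φ ‖x‖ / youngFenchel (zetaKL κ C L) x)
        (minCoordAtTop d) (𝓝 1)) := by
  have hg : IsRegularProfile κ (profileKL κ C L) :=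
    hL.isRegularProfile hLsmooth.continuousOn hκ
  have hfin := hg.exists_forall_mul_sub_le hκ
  have hzeta : (zetaKL κ C L : EuclideanSpace ℝ (Fin d) → ℝ) = fun x => profileKL κ C L ‖x‖ :=
    funext (zetaKL_eq_profileKL κ C L)
  have hconj : (youngFenchel (zetaKL κ C L) : EuclideanSpace ℝ (Fin d) → ℝ)
      = fun x => halfLineConjugate (profileKL κ C L) ‖x‖ := by
    rw [hzeta]; exact funext (youngFenchel_radial hd hfin)
  refine ⟨fun y => ?_, fun lam => ?_, ?_, fun φ hφ h => ?_⟩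
  · obtain ⟨m, hm⟩ := hfin ‖y‖
    rw [hzeta]
    exact ⟨m, by rintro _ ⟨x, rfl⟩; exact (forall_inner_sub_radial_le_iff hd _ y).2 hm x⟩
  · rw [hconj]; exact hg.integrable_laplaceIntegrand_halfLineConjugate hκ lam
  · rw [hconj]; exact hg.tendsto_log_laplaceIntegral_div hd hκ
  · rw [hconj]
    exact (hg.tendsto_radial_div_halfLineConjugate hd hκ hφ h).comp (tendsto_norm_minCoordAtTop hd)
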